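/- Let $\mathbb H=\{z\in\mathbb C:\operatorname{Im}z>0\}$ and let $\mathfrak R$ be the class of univalent analytic functions $f:\mathbb H\to\mathbb H$ for which there is a constant $C\in[0,\infty)$ with $|f(z)-z|\le C/\operatorname{Im}(z)$ for all $z\in\mathbb H$. For $f,g\in\mathfrak R$ write $f\prec g$ ($f$ is subordinate to $g$) if $f=g\circ h$ for some $h\in\mathfrak R$. A chain is a nonempty subset of $\mathfrak R$ that is totally ordered by $\prec$, and a chordal Loewner family is a chain $\mathfrak L$ that is maximal, i.e. $\mathfrak L=\mathfrak C$ for every chain $\mathfrak C\supseteq\mathfrak L$. Let $\mathfrak L$ be a chordal Loewner family with its parametric representation $\mathfrak L=\{f(t;\cdot)\}_{t\in[0,\infty)}$, where $f(t;\cdot)$ satisfies $\lim_{y\to\infty}iy\,[iy-f(t;iy)]=t$ for every $t\ge 0$. Then for $0\le a\le b<\infty$ there is a function $B(a,b;\cdot)\in\mathfrak R$ with $f(b;z)=f(a;B(a,b;z))$ for all $z\in\mathbb H$; $\{B(a,b;\cdot)\}_{0\le a\le b<\infty}$ is called the semigroup associated with $\mathfrak L$. For all $z\in\mathbb H$ and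 $0\le a\le b\le c<\infty$, $$|B(a,c;z)-B(b,c;z)|\le\frac{b-a}{\operatorname{Im}(z)},$$ $$|B(a,b;z)-B(a,c;z)|\le\left(1+\frac{b-a}{\operatorname{Im}(z)^2}\right)\frac{c-b}{\operatorname{Im}(z)}.$$ Consequently, for each $z\in\mathbb H$: (i) the function $t\in[0,\infty)\mapsto f(t;z)\in\mathbb H$ is absolutely continuous; (ii) if $b>0$, the function $a\in[0,b]\mapsto B(a,b;z)\in\mathbb H$ is absolutely continuous; (iii) if $a\ge 0$, the function $b\in[a,\infty)\mapsto B(a,b;z)\in\mathbb H$ is absolutely continuous. Absolute continuity on an unbounded interval means absolute continuity on each of its compact subintervals. -/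

import Mathlib

open UpperHalfPlane Filter Topology
open scoped Manifold

/-- The class of analytic univalent self-maps `f` of the upper half-plane such that
`|f z - z| ≤ C / Im z` on the upper half-plane for some constant `C ∈ [0, ∞)`. -/
def ClassR : Set (ℍ → ℍ) :=
  {f | MDifferentiable 𝓘(ℂ) 𝓘(ℂ) (fun z : ℍ => (f z : ℂ)) ∧ Function.Injective f ∧
    ∃ C : ℝ, 0 ≤ C ∧ ∀ z : ℍ, ‖(f z : ℂ) - (z : ℂ)‖ ≤ C / z.im}

/-- `f` is subordinate to `g`: `f = g ∘ h` for some `h` in the class. -/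
def Subordinate (f g : ℍ → ℍ) : Prop :=
  ∃ h ∈ ClassR, f = g ∘ h

/-- A chain: a nonempty subset of the class, totally ordered by subordination. -/
def IsSubordinationChain (S : Set (ℍ → ℍ)) : Prop :=
  S.Nonempty ∧ S ⊆ ClassR ∧ ∀ f ∈ S, ∀ g ∈ S, Subordinate f g ∨ Subordinate g f

/-- A chordal Loewner family: a maximal chain. -/
def IsChordalLoewnerFamily (L : Set (ℍ → ℍ)) : Prop :=
  IsSubordinationChain L ∧ ∀ S : Set (ℍ → ℍ), IsSubordinationChain S → L ⊆ S → L = S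

/-- `lim_{y → ∞} iy [iy - f(iy)] = t`. (`ofComplex` turns the complex number `iy`, `y > 0`,
into a point of `ℍ`; its values at `y ≤ 0` do not affect the limit.) -/
def HasCapacity (f : ℍ → ℍ) (t : ℝ) : Prop :=
  Tendsto (fun y : ℝ => (Complex.I * (y : ℂ)) *
    (Complex.I * (y : ℂ) - (f (ofComplex (Complex.I * (y : ℂ))) : ℂ))) atTop (𝓝 (t : ℂ))

/-- `f` is the parametric representation `L = {f(t; ·) : t ∈ [0, ∞)}`, in which `f(t; ·)` is the
element of `L` with `lim_{y → ∞} iy [iy - f(t; iy)] = t`. -/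
def IsParametricRepresentation (L : Set (ℍ → ℍ)) (f : ℝ → ℍ → ℍ) : Prop :=
  L = f '' Set.Ici 0 ∧ ∀ t : ℝ, 0 ≤ t → HasCapacity (f t) t

/-- `B` is the semigroup associated to `f`: for `0 ≤ a ≤ b`, `B(a, b; ·)` is the function in the
class with `f(b; z) = f(a; B(a, b; z))`. -/
def IsAssociatedSemigroup (f : ℝ → ℍ → ℍ) (B : ℝ → ℝ → ℍ → ℍ) : Prop :=
  ∀ a b : ℝ, 0 ≤ a → a ≤ b → B a b ∈ ClassR ∧ ∀ z : ℍ, f b z = f a (B a b z)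

open scoped ComplexConjugate

/-! For `h` in the class, the displacement `h z - z` has nonnegative imaginary part, by
Phragmén–Lindelöf. Schwarz–Pick for this displacement has two consequences. Sending one point to
`i∞` shows that the capacity `l` of `h` serves as its constant: `|h z - z| ≤ l / Im z`. At two
finite points it gives a Lipschitz bound for `h` with factor `1 + l / (Im z Im w)`.

Capacity is additive under composition, so `B a b` has capacity `b - a`, and injectivity of `f a`
gives `B a c = B a b ∘ B b c`. The first estimate is the displacement bound for `B a b` at `B b c
z`; the second is its Lipschitz bound between `z` and `B b c z`. Both make the curves locally
Lipschitz, and `f t = B 0 t`. -/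

lemma sq_norm_sub_conj (u v : ℂ) :
    ‖u - conj v‖ ^ 2 = ‖u - v‖ ^ 2 + 4 * (u.im * v.im) := by
  simp only [Complex.sq_norm, Complex.normSq_apply, Complex.sub_re, Complex.sub_im,
    Complex.conj_re, Complex.conj_im]
  ring

lemma sub_conj_ne_zero {u v : ℂ} (hu : 0 < u.im) (hv : 0 < v.im) : u - conj v ≠ 0 := by
  intro h
  have := congrArg Complex.im h
  simp at this
  linarith

/-- The Schwarz–Pick lemma for the upper half-plane, in terms of pseudo-hyperbolic distances. -/
lemma norm_sub_mul_norm_sub_conj_le {F : ℂ → ℂ} (hF : DifferentiableOn ℂ F {z | 0 < z.im})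
    (hpos : ∀ z : ℂ, 0 < z.im → 0 < (F z).im) {z w : ℂ} (hz : 0 < z.im) (hw : 0 < w.im) :
    ‖F z - F w‖ * ‖z - conj w‖ ≤ ‖z - w‖ * ‖F z - conj (F w)‖ := by
  -- Inverse Cayley map of the disc with `0 ↦ w`; it turns `F` into `G`, to which the Schwarz lemma
  -- at `0` applies.
  set ψ : ℂ → ℂ := fun ζ => (w - conj w * ζ) / (1 - ζ) with hψ
  have hne : ∀ ζ ∈ Metric.ball (0 : ℂ) 1, 1 - ζ ≠ 0 := by
    intro ζ hζ h
    rw [← sub_eq_zero.mp h] at hζ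
    simp at hζ
  have hψim : ∀ ζ ∈ Metric.ball (0 : ℂ) 1, 0 < (ψ ζ).im := by
    intro ζ hζ
    have h1 := hne ζ hζ
    have e1 : ψ ζ - w = ζ * (ψ ζ - conj w) := by
      simp only [hψ]
      field_simp
      ring
    have e2 : ψ ζ - conj w = (w - conj w) / (1 - ζ) := by
      simp only [hψ]
      field_simp
      ring
    have h2 : 0 < ‖ψ ζ - conj w‖ := by
      rw [e2]
      exact norm_pos_iff.mpr (div_ne_zero (sub_conj_ne_zero hw hw) h1)
    have h3 : ‖ψ ζ - w‖ < ‖ψ ζ - conj w‖ := by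
      rw [e1, norm_mul]
      have : ‖ζ‖ < 1 := by simpa using hζ
      nlinarith
    have h4 := sq_norm_sub_conj (ψ ζ) w
    have h5 : ‖ψ ζ - w‖ ^ 2 < ‖ψ ζ - conj w‖ ^ 2 := by gcongr
    have h6 : 0 < (ψ ζ).im * w.im := by linarith
    exact pos_of_mul_pos_left h6 hw.le
  set G : ℂ → ℂ := fun ζ => (F (ψ ζ) - F w) / (F (ψ ζ) - conj (F w)) with hG
  have hψd : DifferentiableOn ℂ ψ (Metric.ball 0 1) :=
    DifferentiableOn.div (by fun_prop) (by fun_prop) hne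
  have hFψ : DifferentiableOn ℂ (fun ζ => F (ψ ζ)) (Metric.ball 0 1) := hF.comp hψd hψim
  have hGd : DifferentiableOn ℂ G (Metric.ball 0 1) :=
    (hFψ.sub_const _).div (hFψ.sub_const _)
      fun ζ hζ => sub_conj_ne_zero (hpos _ (hψim ζ hζ)) (hpos w hw)
  have hGm : Set.MapsTo G (Metric.ball 0 1) (Metric.closedBall 0 1) := by
    intro ζ hζ
    have hu := hpos _ (hψim ζ hζ)
    have hv := hpos w hw
    have h2 := norm_pos_iff.mpr (sub_conj_ne_zero hu hv)
    rw [mem_closedBall_zero_iff, norm_div, div_le_one h2]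
    have h4 := sq_norm_sub_conj (F (ψ ζ)) (F w)
    exact le_of_sq_le_sq (by nlinarith [mul_pos hu hv]) h2.le
  have hG0 : G 0 = 0 := by simp [hG, hψ]
  have hzw := sub_conj_ne_zero hz hw
  have hζn : ‖(z - w) / (z - conj w)‖ < 1 := by
    have h2 := norm_pos_iff.mpr hzw
    rw [norm_div, div_lt_one h2]
    exact lt_of_pow_lt_pow_left₀ 2 h2.le (by nlinarith [sq_norm_sub_conj z w, mul_pos hz hw])
  have hζψ : ψ ((z - w) / (z - conj w)) = z := by
    have := hne _ (mem_ball_zero_iff.mpr hζn)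
    simp only [hψ]
    rw [div_eq_iff this]
    field_simp
    ring
  have key := Complex.norm_le_norm_of_mapsTo_ball hGd hGm hG0 hζn
  simp only [hG, hζψ, norm_div] at key
  rwa [div_le_div_iff₀ (norm_pos_iff.mpr (sub_conj_ne_zero (hpos z hz) (hpos w hw)))
    (norm_pos_iff.mpr hzw)] at key

/-- The Schwarz–Pick lemma for maps into the closed upper half-plane. -/
lemma sq_norm_sub_mul_le {F : ℂ → ℂ} (hF : DifferentiableOn ℂ F {z | 0 < z.im})
    (hnn : ∀ z : ℂ, 0 < z.im → 0 ≤ (F z).im) {z w : ℂ} (hz : 0 < z.im) (hw : 0 < w.im) :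
    ‖F z - F w‖ ^ 2 * (z.im * w.im) ≤ (F z).im * (F w).im * ‖z - w‖ ^ 2 := by
  have hε : ∀ ε : ℝ, 0 < ε →
      ‖F z - F w‖ ^ 2 * (z.im * w.im) ≤ ((F z).im + ε) * ((F w).im + ε) * ‖z - w‖ ^ 2 := by
    intro ε hε
    -- The shift by `iε` enters the open half-plane; after squaring, `‖z - w‖² ‖F z - F w‖²` cancels
    -- from both sides.
    have h := norm_sub_mul_norm_sub_conj_le (F := fun z => F z + ε * Complex.I) (hF.add_const _)
      (fun z hz => by simpa using add_pos_of_nonneg_of_pos (hnn z hz) hε) hz hw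
    have h2 := pow_le_pow_left₀ (by positivity) h 2
    rw [mul_pow, mul_pow, sq_norm_sub_conj, sq_norm_sub_conj] at h2
    simp at h2
    linarith
  have hlim : Tendsto (fun ε : ℝ => ((F z).im + ε) * ((F w).im + ε) * ‖z - w‖ ^ 2) (𝓝[>] 0)
      (𝓝 (((F z).im + 0) * ((F w).im + 0) * ‖z - w‖ ^ 2)) :=
    (Continuous.tendsto (by fun_prop) 0).mono_left nhdsWithin_le_nhds
  simp only [add_zero] at hlim
  exact ge_of_tendsto hlim (eventually_nhdsWithin_of_forall hε)

/-- `exp (iF)` has modulus `exp (-Im F)`: bounded on `Im ≥ ε`, and at most `exp ε` on the line `Im =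
ε`. Phragmén–Lindelöf carries the latter bound upward; then `ε → 0`. -/
lemma im_nonneg_of_norm_le_div_im {F : ℂ → ℂ} (hF : DifferentiableOn ℂ F {z | 0 < z.im})
    {C : ℝ} (hC : 0 ≤ C) (hb : ∀ z : ℂ, 0 < z.im → ‖F z‖ ≤ C / z.im)
    (him : ∀ z : ℂ, 0 < z.im → -z.im ≤ (F z).im) {z : ℂ} (hz : 0 < z.im) : 0 ≤ (F z).im := by
  have hlow : ∀ ε : ℝ, 0 < ε → ε < z.im → -ε ≤ (F z).im := by
    intro ε hε hεz
    set G : ℂ → ℂ := fun w => Complex.exp (Complex.I * F (Complex.I * w + ε * Complex.I)) with hG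
    have hnorm : ∀ w, ‖G w‖ = Real.exp (-(F (Complex.I * w + ε * Complex.I)).im) := by
      intro w
      simp [hG, Complex.norm_exp]
    have hbd : ∀ w : ℂ, 0 ≤ w.re → ‖G w‖ ≤ Real.exp (C / ε) := by
      intro w hw
      rw [hnorm, Real.exp_le_exp]
      have h1 : (Complex.I * w + ε * Complex.I).im = w.re + ε := by simp
      have h2 := hb (Complex.I * w + ε * Complex.I) (by rw [h1]; positivity)
      rw [h1] at h2
      have h3 : C / (w.re + ε) ≤ C / ε := by gcongr; linarith
      have h4 := Complex.abs_im_le_norm (F (Complex.I * w + ε * Complex.I))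
      linarith [neg_le_abs (F (Complex.I * w + ε * Complex.I)).im]
    have hd : DiffContOnCl ℂ G {w | 0 < w.re} := by
      apply DifferentiableOn.diffContOnCl
      rw [Complex.closure_setOfPred_lt_re]
      refine DifferentiableOn.cexp (DifferentiableOn.const_mul ?_ Complex.I)
      refine hF.comp (by fun_prop) ?_
      intro w hw
      have hw' : 0 ≤ w.re := hw
      have h1 : (Complex.I * w + ε * Complex.I).im = w.re + ε := by simp
      simp only [Set.mem_ofPred_eq, h1]
      positivity
    have key := PhragmenLindelof.right_half_plane_of_bounded_on_real (C := Real.exp ε)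
      (z := -Complex.I * (z - ε * Complex.I)) hd ?_ ?_ ?_ ?_
    · rw [hnorm, Real.exp_le_exp] at key
      have : Complex.I * (-Complex.I * (z - ε * Complex.I)) + ε * Complex.I = z := by
        linear_combination (-(z - ε * Complex.I)) * Complex.I_mul_I
      rw [this] at key
      linarith
    · refine ⟨0, by norm_num, 0, ?_⟩
      refine Asymptotics.IsBigO.of_bound (Real.exp (C / ε)) ?_
      refine eventually_inf_principal.mpr (Eventually.of_forall fun w hw => ?_)
      simpa using hbd w (le_of_lt hw)
    · refine isBoundedUnder_of_eventually_le (a := Real.exp (C / ε)) ?_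
      filter_upwards [eventually_ge_atTop 0] with x hx
      exact hbd x (by simpa using hx)
    · intro x
      rw [hnorm, Real.exp_le_exp]
      have h1 : (Complex.I * (x * Complex.I) + ε * Complex.I).im = ε := by simp
      have := him (Complex.I * (x * Complex.I) + ε * Complex.I) (by rw [h1]; exact hε)
      rw [h1] at this
      linarith
    · simp
      exact hεz.le
  have hlim : Tendsto (fun ε : ℝ => -ε) (𝓝[>] 0) (𝓝 0) := by
    have : Tendsto (fun ε : ℝ => -ε) (𝓝 0) (𝓝 (-0)) := tendsto_id.neg
    rw [neg_zero] at this
    exact this.mono_left nhdsWithin_le_nhds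
  refine le_of_tendsto hlim ?_
  filter_upwards [Ioo_mem_nhdsGT hz] with ε hε
  exact hlow ε hε.1 hε.2

/-! ### Displacement estimates in the class -/

namespace ClassR

lemma differentiableOn_displacement {h : ℍ → ℍ} (hh : h ∈ ClassR) :
    DifferentiableOn ℂ (fun z : ℂ => (h (ofComplex z) : ℂ) - z) {z | 0 < z.im} :=
  (UpperHalfPlane.mdifferentiable_iff.mp hh.1).sub differentiableOn_id

lemma im_displacement_nonneg {h : ℍ → ℍ} (hh : h ∈ ClassR) {z : ℂ} (hz : 0 < z.im) :
    0 ≤ ((h (ofComplex z) : ℂ) - z).im := by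
  obtain ⟨C, hC, hb⟩ := hh.2.2
  refine im_nonneg_of_norm_le_div_im (differentiableOn_displacement hh) hC ?_ ?_ hz
  · intro z hz
    have := hb (ofComplex z)
    rwa [ofComplex_apply_of_im_pos hz] at this ⊢
  · intro z hz
    have := (h (ofComplex z)).im_pos
    rw [Complex.sub_im]
    change _ ≤ (h (ofComplex z)).im - z.im
    linarith

lemma im_le_im_apply {h : ℍ → ℍ} (hh : h ∈ ClassR) (z : ℍ) : z.im ≤ (h z).im := by
  have := im_displacement_nonneg hh z.im_pos
  rw [ofComplex_apply, Complex.sub_im] at this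
  change 0 ≤ (h z).im - z.im at this
  linarith

/-- The Schwarz–Pick inequality for the displacement `h z - z`. -/
lemma sq_norm_displacement_sub_mul_le {h : ℍ → ℍ} (hh : h ∈ ClassR) (z w : ℍ) :
    ‖((h z : ℂ) - z) - ((h w : ℂ) - w)‖ ^ 2 * (z.im * w.im) ≤
      ((h z : ℂ) - z).im * ((h w : ℂ) - w).im * ‖(z : ℂ) - w‖ ^ 2 := by
  have := sq_norm_sub_mul_le (differentiableOn_displacement hh)
    (fun _ => im_displacement_nonneg hh) z.im_pos w.im_pos
  simpa only [ofComplex_apply] using! this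

lemma norm_displacement_sub_le {h : ℍ → ℍ} (hh : h ∈ ClassR) {C : ℝ}
    (hC : ∀ z : ℍ, ‖(h z : ℂ) - z‖ ≤ C / z.im) (z w : ℍ) :
    ‖((h z : ℂ) - z) - ((h w : ℂ) - w)‖ ≤ C / (z.im * w.im) * ‖(z : ℂ) - w‖ := by
  have hz := z.im_pos
  have hw := w.im_pos
  have hC0 : 0 ≤ C := by
    have := (norm_nonneg _).trans (hC z)
    rwa [le_div_iff₀ hz, zero_mul] at this
  have bd : ∀ u : ℍ, ((h u : ℂ) - u).im ≤ C / u.im := fun u =>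
    (Complex.im_le_norm _).trans (hC u)
  have nn : ∀ u : ℍ, 0 ≤ ((h u : ℂ) - u).im := fun u => by
    simpa only [ofComplex_apply] using! im_displacement_nonneg hh u.im_pos
  have hmul : ((h z : ℂ) - z).im * ((h w : ℂ) - w).im ≤ C / z.im * (C / w.im) :=
    mul_le_mul (bd z) (bd w) (nn w) (by positivity)
  have key := sq_norm_displacement_sub_mul_le hh z w
  refine le_of_sq_le_sq ?_ (by positivity)
  have h2 : ‖((h z : ℂ) - z) - ((h w : ℂ) - w)‖ ^ 2 * (z.im * w.im) ≤
      C / z.im * (C / w.im) * ‖(z : ℂ) - w‖ ^ 2 := key.trans (by gcongr)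
  rw [← le_div_iff₀ (by positivity)] at h2
  refine h2.trans (le_of_eq ?_)
  field_simp

lemma norm_apply_sub_apply_le {h : ℍ → ℍ} (hh : h ∈ ClassR) {C : ℝ}
    (hC : ∀ z : ℍ, ‖(h z : ℂ) - z‖ ≤ C / z.im) (z w : ℍ) :
    ‖(h z : ℂ) - h w‖ ≤ (1 + C / (z.im * w.im)) * ‖(z : ℂ) - w‖ := by
  calc ‖(h z : ℂ) - h w‖ = ‖((z : ℂ) - w) + (((h z : ℂ) - z) - ((h w : ℂ) - w))‖ := by
        congr 1; ring
    _ ≤ ‖(z : ℂ) - w‖ + C / (z.im * w.im) * ‖(z : ℂ) - w‖ :=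
        (norm_add_le _ _).trans (by gcongr; exact norm_displacement_sub_le hh hC z w)
    _ = _ := by ring

lemma id_mem : (id : ℍ → ℍ) ∈ ClassR :=
  ⟨UpperHalfPlane.mdifferentiable_coe, Function.injective_id, 0, le_rfl, by simp⟩

end ClassR

/-! ### Capacity: sharp constant and additivity -/

lemma coe_ofComplex_I_mul {y : ℝ} (hy : 0 < y) :
    ((ofComplex (Complex.I * (y : ℂ)) : ℍ) : ℂ) = Complex.I * (y : ℂ) := by
  rw [ofComplex_apply_of_im_pos (by simpa using hy)]

lemma im_ofComplex_I_mul {y : ℝ} (hy : 0 < y) :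
    (ofComplex (Complex.I * (y : ℂ)) : ℍ).im = y := by
  have := congrArg Complex.im (coe_ofComplex_I_mul hy)
  simpa using! this

namespace HasCapacity

lemma nonneg {h : ℍ → ℍ} {l : ℝ} (hl : HasCapacity h l) (hh : h ∈ ClassR) : 0 ≤ l := by
  have h1 := (Complex.continuous_re.tendsto _).comp hl
  refine ge_of_tendsto h1 ?_
  filter_upwards [eventually_gt_atTop 0] with y hy
  have h2 := ClassR.im_displacement_nonneg hh (z := Complex.I * (y : ℂ)) (by simpa using hy)
  have h3 := mul_nonneg hy.le h2
  simp at h3 ⊢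
  linarith

/-- The capacity of `h` is an admissible constant in the defining estimate of the class. -/
lemma norm_apply_sub_le {h : ℍ → ℍ} {l : ℝ} (hl : HasCapacity h l) (hh : h ∈ ClassR) (z : ℍ) :
    ‖(h z : ℂ) - z‖ ≤ l / z.im := by
  obtain ⟨C, hC, hb⟩ := hh.2.2
  have hl0 := hl.nonneg hh
  have hz := z.im_pos
  set p : ℂ := (h z : ℂ) - z with hp
  set W : ℝ → ℂ := fun y => (h (ofComplex (Complex.I * (y : ℂ))) : ℂ) - Complex.I * (y : ℂ)
    with hW
  have hW0 : Tendsto W atTop (𝓝 0) := by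
    refine squeeze_zero_norm' ?_ (tendsto_id.const_div_atTop C)
    filter_upwards [eventually_gt_atTop 0] with y hy
    have := hb (ofComplex (Complex.I * (y : ℂ)))
    rwa [coe_ofComplex_I_mul hy, im_ofComplex_I_mul hy] at this
  have hWl : Tendsto (fun y => y * (W y).im) atTop (𝓝 l) := by
    have h1 := (Complex.continuous_re.tendsto _).comp hl
    refine h1.congr fun y => ?_
    simp [hW]
    ring
  have hr : Tendsto (fun y : ℝ => ‖(z : ℂ) * ((y⁻¹ : ℝ) : ℂ) - Complex.I‖ ^ 2) atTop (𝓝 1) := by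
    have h0 : Tendsto (fun y : ℝ => ((y⁻¹ : ℝ) : ℂ)) atTop (𝓝 ((0 : ℝ) : ℂ)) :=
      (Complex.continuous_ofReal.tendsto 0).comp tendsto_inv_atTop_zero
    have h1 := (((h0.const_mul (z : ℂ)).sub_const Complex.I).norm).pow 2
    simpa using h1
  have hL : Tendsto (fun y => ‖p - W y‖ ^ 2 * z.im) atTop (𝓝 (‖p‖ ^ 2 * z.im)) := by
    simpa using (((hW0.const_sub p).norm).pow 2).mul_const z.im
  have hR := (hWl.const_mul p.im).mul hr
  -- Schwarz–Pick at `z` and `iy`, divided by `y`, in the limit `y → ∞`. With `Im p ≤ ‖p‖` this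
  -- yields the claim.
  have hle : ‖p‖ ^ 2 * z.im ≤ p.im * l * 1 := by
    refine le_of_tendsto_of_tendsto hL hR ?_
    filter_upwards [eventually_gt_atTop 0] with y hy
    have h1 := ClassR.sq_norm_displacement_sub_mul_le hh z (ofComplex (Complex.I * (y : ℂ)))
    rw [coe_ofComplex_I_mul hy, im_ofComplex_I_mul hy] at h1
    have h2 : (z : ℂ) - Complex.I * (y : ℂ) =
        (y : ℂ) * ((z : ℂ) * ((y⁻¹ : ℝ) : ℂ) - Complex.I) := by
      have : (y : ℂ) ≠ 0 := by exact_mod_cast hy.ne'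
      push_cast
      field_simp
    rw [h2, norm_mul, Complex.norm_of_nonneg hy.le] at h1
    refine le_of_mul_le_mul_right ?_ hy
    calc _ = ‖p - W y‖ ^ 2 * (z.im * y) := by ring
      _ ≤ _ := h1
      _ = _ := by simp only [hp, hW]; ring
  have him : p.im ≤ ‖p‖ := Complex.im_le_norm p
  rw [le_div_iff₀ hz]
  rcases (norm_nonneg p).eq_or_lt with h0 | h0
  · rw [← h0, zero_mul]
    exact hl0
  · refine le_of_mul_le_mul_left ?_ h0
    nlinarith [mul_le_mul_of_nonneg_right him hl0]

lemma eq_id {h : ℍ → ℍ} (hl : HasCapacity h 0) (hh : h ∈ ClassR) : h = id := by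
  funext z
  have := hl.norm_apply_sub_le hh z
  rw [zero_div, norm_le_zero_iff, sub_eq_zero] at this
  exact UpperHalfPlane.ext this

/-- If `f ∘ h` has capacity `t` and `f` has capacity `s`, then `h` has capacity `t - s`. -/
lemma of_comp {f h : ℍ → ℍ} {s t : ℝ} (hfh : HasCapacity (f ∘ h) t) (hf : HasCapacity f s)
    (hfR : f ∈ ClassR) (hhR : h ∈ ClassR) : HasCapacity h (t - s) := by
  obtain ⟨C, hC, hb⟩ := hhR.2.2
  have hs := hf.nonneg hfR
  -- The defect from additivity: `iy` times the change of the displacement of `f` from `w = iy` to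
  -- `h w`. The Lipschitz bound makes it at most `sC / y²`.
  set E : ℝ → ℂ := fun y =>
    let w : ℍ := ofComplex (Complex.I * (y : ℂ))
    Complex.I * (y : ℂ) * (((f (h w) : ℂ) - h w) - ((f w : ℂ) - Complex.I * (y : ℂ))) with hE
  have hE0 : Tendsto E atTop (𝓝 0) := by
    have hlim : Tendsto (fun y : ℝ => s * C / y ^ 2) atTop (𝓝 0) :=
      (tendsto_pow_atTop two_ne_zero).const_div_atTop _
    refine squeeze_zero_norm' ?_ hlim
    filter_upwards [eventually_gt_atTop 0] with y hy
    simp only [hE]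
    set w : ℍ := ofComplex (Complex.I * (y : ℂ)) with hw
    have hwc : (w : ℂ) = Complex.I * (y : ℂ) := coe_ofComplex_I_mul hy
    have hwi : w.im = y := im_ofComplex_I_mul hy
    have h1 := ClassR.norm_displacement_sub_le hfR (hf.norm_apply_sub_le hfR) (h w) w
    have h2 := hb w
    have h3 := ClassR.im_le_im_apply hhR w
    rw [hwi] at h1 h2 h3
    rw [← hwc, norm_mul, hwc, norm_mul, Complex.norm_I, one_mul, Complex.norm_of_nonneg hy.le,
      ← hwc]
    calc _ ≤ y * (s / ((h w).im * y) * ‖(h w : ℂ) - w‖) := by gcongr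
      _ ≤ y * (s / (y * y) * (C / y)) := by gcongr
      _ = _ := by field_simp
  have h := (hfh.sub hf).add hE0
  rw [add_zero, ← Complex.ofReal_sub] at h
  refine h.congr fun y => ?_
  simp only [hE, Function.comp_apply]
  ring

end HasCapacity

lemma absolutelyContinuousOnInterval_of_norm_sub_le {u : ℝ → ℂ} {a b K : ℝ} (hab : a ≤ b)
    (hK : 0 ≤ K) (h : ∀ s t, a ≤ s → s ≤ t → t ≤ b → ‖u s - u t‖ ≤ K * (t - s)) :
    AbsolutelyContinuousOnInterval u a b := by
  refine LipschitzOnWith.absolutelyContinuousOnInterval (K := K.toNNReal) ?_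
  refine LipschitzOnWith.of_dist_le_mul fun x hx y hy => ?_
  rw [Set.uIcc_of_le hab] at hx hy
  rw [Real.coe_toNNReal K hK, dist_eq_norm, Real.dist_eq]
  rcases le_total x y with hxy | hxy
  · rw [abs_sub_comm, abs_of_nonneg (sub_nonneg.mpr hxy)]
    exact h x y hx.1 hxy hy.2
  · rw [norm_sub_rev, abs_of_nonneg (sub_nonneg.mpr hxy)]
    exact h y x hy.1 hxy hx.2

/-! ### The semigroup of a chain -/

section Family

variable {L : Set (ℍ → ℍ)} {f : ℝ → ℍ → ℍ} {B : ℝ → ℝ → ℍ → ℍ}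

lemma IsParametricRepresentation.mem_classR (hf : IsParametricRepresentation L f)
    (hL : IsSubordinationChain L) {t : ℝ} (ht : 0 ≤ t) : f t ∈ ClassR :=
  hL.2.1 (hf.1 ▸ Set.mem_image_of_mem f ht)

lemma IsParametricRepresentation.subordinate (hf : IsParametricRepresentation L f)
    (hL : IsSubordinationChain L) {a b : ℝ} (ha : 0 ≤ a) (hab : a ≤ b) :
    Subordinate (f b) (f a) := by
  have hb := ha.trans hab
  have hmem : ∀ t, 0 ≤ t → f t ∈ L := fun t ht => hf.1 ▸ Set.mem_image_of_mem f ht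
  rcases hL.2.2 (f b) (hmem b hb) (f a) (hmem a ha) with h | ⟨h, hh, he⟩
  · exact h
  -- In the reverse order `h` would have capacity `a - b ≥ 0`, which forces `a = b`.
  · have hcap := (he ▸ hf.2 a ha).of_comp (hf.2 b hb) (hf.mem_classR hL hb) hh
    have hba : a = b := le_antisymm hab (sub_nonneg.mp (hcap.nonneg hh))
    exact ⟨id, ClassR.id_mem, by rw [hba]; rfl⟩

lemma IsParametricRepresentation.exists_isAssociatedSemigroup
    (hf : IsParametricRepresentation L f) (hL : IsSubordinationChain L) :
    ∃ B : ℝ → ℝ → ℍ → ℍ, IsAssociatedSemigroup f B := by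
  have : ∀ a b : ℝ, ∃ h : ℍ → ℍ, 0 ≤ a → a ≤ b → h ∈ ClassR ∧ f b = f a ∘ h := by
    intro a b
    by_cases hab : 0 ≤ a ∧ a ≤ b
    · obtain ⟨h, hh⟩ := hf.subordinate hL hab.1 hab.2
      exact ⟨h, fun _ _ => hh⟩
    · exact ⟨id, fun h1 h2 => absurd ⟨h1, h2⟩ hab⟩
  choose B hB using this
  exact ⟨B, fun a b ha hab => ⟨(hB a b ha hab).1, congrFun (hB a b ha hab).2⟩⟩

lemma IsAssociatedSemigroup.hasCapacity (hB : IsAssociatedSemigroup f B)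
    (hf : IsParametricRepresentation L f) (hL : IsSubordinationChain L) {a b : ℝ}
    (ha : 0 ≤ a) (hab : a ≤ b) : HasCapacity (B a b) (b - a) := by
  obtain ⟨hR, he⟩ := hB a b ha hab
  have he' : f b = f a ∘ B a b := funext he
  exact (he' ▸ hf.2 b (ha.trans hab)).of_comp (hf.2 a ha) (hf.mem_classR hL ha) hR

lemma IsAssociatedSemigroup.apply_apply (hB : IsAssociatedSemigroup f B)
    (hf : IsParametricRepresentation L f) (hL : IsSubordinationChain L) {a b c : ℝ}
    (ha : 0 ≤ a) (hab : a ≤ b) (hbc : b ≤ c) (z : ℍ) : B a c z = B a b (B b c z) := by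
  apply (hf.mem_classR hL ha).2.1
  rw [← (hB a c ha (hab.trans hbc)).2, ← (hB a b ha hab).2, ← (hB b c (ha.trans hab) hbc).2]

lemma IsAssociatedSemigroup.norm_sub_le_left (hB : IsAssociatedSemigroup f B)
    (hf : IsParametricRepresentation L f) (hL : IsSubordinationChain L) {a b c : ℝ}
    (ha : 0 ≤ a) (hab : a ≤ b) (hbc : b ≤ c) (z : ℍ) :
    ‖(B a c z : ℂ) - B b c z‖ ≤ (b - a) / z.im := by
  rw [hB.apply_apply hf hL ha hab hbc]
  refine ((hB.hasCapacity hf hL ha hab).norm_apply_sub_le (hB a b ha hab).1 _).trans ?_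
  exact div_le_div_of_nonneg_left (sub_nonneg.mpr hab) z.im_pos
    (ClassR.im_le_im_apply (hB b c (ha.trans hab) hbc).1 z)

lemma IsAssociatedSemigroup.norm_sub_le_right (hB : IsAssociatedSemigroup f B)
    (hf : IsParametricRepresentation L f) (hL : IsSubordinationChain L) {a b c : ℝ}
    (ha : 0 ≤ a) (hab : a ≤ b) (hbc : b ≤ c) (z : ℍ) :
    ‖(B a b z : ℂ) - B a c z‖ ≤ (1 + (b - a) / z.im ^ 2) * ((c - b) / z.im) := by
  have hb := ha.trans hab
  have hz := z.im_pos
  have hba := sub_nonneg.mpr hab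
  have hR := (hB b c hb hbc).1
  have h1 := ClassR.norm_apply_sub_apply_le (hB a b ha hab).1
    ((hB.hasCapacity hf hL ha hab).norm_apply_sub_le (hB a b ha hab).1) z (B b c z)
  have h2 := (hB.hasCapacity hf hL hb hbc).norm_apply_sub_le hR z
  rw [norm_sub_rev] at h2
  have h3 := ClassR.im_le_im_apply hR z
  rw [hB.apply_apply hf hL ha hab hbc]
  refine h1.trans ?_
  rw [pow_two]
  gcongr

lemma IsAssociatedSemigroup.absolutelyContinuousOnInterval_right
    (hB : IsAssociatedSemigroup f B) (hf : IsParametricRepresentation L f)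
    (hL : IsSubordinationChain L) {a T : ℝ} (ha : 0 ≤ a) (haT : a ≤ T) (z : ℍ) :
    AbsolutelyContinuousOnInterval (fun b : ℝ => (B a b z : ℂ)) a T := by
  have hz := z.im_pos
  have haT' := sub_nonneg.mpr haT
  refine absolutelyContinuousOnInterval_of_norm_sub_le (K := (1 + (T - a) / z.im ^ 2) / z.im)
    haT (by positivity) fun s t hs hst ht => ?_
  refine (hB.norm_sub_le_right hf hL ha hs hst z).trans ?_
  have hts := sub_nonneg.mpr hst
  calc _ ≤ (1 + (T - a) / z.im ^ 2) * ((t - s) / z.im) := by gcongr; linarith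
    _ = _ := by ring

lemma IsAssociatedSemigroup.absolutelyContinuousOnInterval_left
    (hB : IsAssociatedSemigroup f B) (hf : IsParametricRepresentation L f)
    (hL : IsSubordinationChain L) {b : ℝ} (hb : 0 ≤ b) (z : ℍ) :
    AbsolutelyContinuousOnInterval (fun a : ℝ => (B a b z : ℂ)) 0 b := by
  have hz := z.im_pos
  refine absolutelyContinuousOnInterval_of_norm_sub_le (K := 1 / z.im)
    hb (by positivity) fun s t hs hst ht => ?_
  refine (hB.norm_sub_le_left hf hL hs hst ht z).trans (le_of_eq ?_)
  ring

/-- Capacity zero forces `f 0 = id`, so the regularity of `f` in `t` is that of the semigroup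
started at `0`. -/
lemma IsAssociatedSemigroup.zero_apply (hB : IsAssociatedSemigroup f B)
    (hf : IsParametricRepresentation L f) (hL : IsSubordinationChain L) {t : ℝ} (ht : 0 ≤ t) :
    B 0 t = f t := by
  have h0 := (hf.2 0 le_rfl).eq_id (hf.mem_classR hL le_rfl)
  funext z
  rw [(hB 0 t le_rfl ht).2 z, h0, id]

end Family

theorem theoremT (L : Set (ℍ → ℍ)) (hL : IsChordalLoewnerFamily L)
    (f : ℝ → ℍ → ℍ) (hf : IsParametricRepresentation L f) :
    (∃ B : ℝ → ℝ → ℍ → ℍ, IsAssociatedSemigroup f B) ∧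
    ∀ B : ℝ → ℝ → ℍ → ℍ, IsAssociatedSemigroup f B →
      (∀ z : ℍ, ∀ a b c : ℝ, 0 ≤ a → a ≤ b → b ≤ c →
        ‖(B a c z : ℂ) - (B b c z : ℂ)‖ ≤ (b - a) / z.im ∧
        ‖(B a b z : ℂ) - (B a c z : ℂ)‖ ≤ (1 + (b - a) / z.im ^ 2) * ((c - b) / z.im)) ∧
      (∀ z : ℍ,
        (∀ T : ℝ, 0 ≤ T →
          AbsolutelyContinuousOnInterval (fun t : ℝ => (f t z : ℂ)) 0 T) ∧
        (∀ b : ℝ, 0 < b →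
          AbsolutelyContinuousOnInterval (fun a : ℝ => (B a b z : ℂ)) 0 b) ∧
        (∀ a : ℝ, 0 ≤ a → ∀ T : ℝ, a ≤ T →
          AbsolutelyContinuousOnInterval (fun b : ℝ => (B a b z : ℂ)) a T)) := by
  have hL' := hL.1
  refine ⟨hf.exists_isAssociatedSemigroup hL', fun B hB => ⟨fun z a b c ha hab hbc =>
    ⟨hB.norm_sub_le_left hf hL' ha hab hbc z, hB.norm_sub_le_right hf hL' ha hab hbc z⟩,
    fun z => ⟨fun T hT => ?_,
      fun b hb => hB.absolutelyContinuousOnInterval_left hf hL' hb.le z,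
      fun a ha T haT => hB.absolutelyContinuousOnInterval_right hf hL' ha haT z⟩⟩⟩
  refine absolutelyContinuousOnInterval_of_norm_sub_le (K := (1 + T / z.im ^ 2) / z.im)
    hT (by have := z.im_pos; positivity) fun s t hs hst ht => ?_
  have hz := z.im_pos
  have hts := sub_nonneg.mpr hst
  rw [← hB.zero_apply hf hL' hs, ← hB.zero_apply hf hL' (hs.trans hst)]
  refine (hB.norm_sub_le_right hf hL' le_rfl hs hst z).trans ?_
  calc _ ≤ (1 + T / z.im ^ 2) * ((t - s) / z.im) := by gcongr; linarith
    _ = _ := by ring
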